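/- Let $\mathfrak{vect}(1)$ be the real Lie algebra of polynomial vector fields $X\frac{d}{dx}$, $X\in\mathbb{R}[x]$, and let $\mathfrak{aff}(1)$ be its Lie subalgebra generated by $\frac{d}{dx}$ and $x\frac{d}{dx}$. For $\lambda\in\mathbb{R}$ let $\mathcal{F}_\lambda=\{f\,dx^\lambda : f\in\mathbb{R}[x]\}$ be the $\mathfrak{vect}(1)$-module of polynomial densities of weight $\lambda$, with action $L^\lambda_{X\frac{d}{dx}}(f)=Xf'+\lambda X'f$. For $\lambda,\mu\in\mathbb{R}$ let $\mathrm{D}_{\lambda,\mu}$ be the $\mathfrak{vect}(1)$-module of linear differential operators $\mathcal{F}_\lambda\to\mathcal{F}_\mu$ (finite sums $f\mapsto\sum_k a_k f^{(k)}$ with $a_k\in\mathbb{R}[x]$), with action $X\cdot A=L^\mu_X\circ A-A\circ L^\lambda_X$. Let $Z^1$ be the space of linear maps $\Upsilon:\mathfrak{vect}(1)\to\mathrm{D}_{\lambda,\mu}$ that vanish on $\mathfrak{aff}(1)$, are $\mathfrak{aff}(1)$-equivariant, are differential (i.e. $(X,f)\mapsto\Upsilon(X\frac{d}{dx})(f)$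 is a finite sum $\sum_{i,j}a_{ij}X^{(i)}f^{(j)}$ with $a_{ij}\in\mathbb{R}[x]$), and satisfy the cocycle condition $U\cdot\Upsilon(V)-V\cdot\Upsilon(U)-\Upsilon([U,V])=0$ for all $U,V\in\mathfrak{vect}(1)$. Let $B^1\subseteq Z^1$ be the space of the maps $U\mapsto U\cdot A$, where $A\in\mathrm{D}_{\lambda,\mu}$ is $\mathfrak{aff}(1)$-invariant. Put $\mathrm{H}^1_{\mathrm{diff}}(\mathfrak{vect}(1),\mathfrak{aff}(1);\mathrm{D}_{\lambda,\mu})=Z^1/B^1$. **Theorem.** For all $\lambda,\mu\in\mathbb{R}$, $$\mathrm{H}^1_{\mathrm{diff}}(\mathfrak{vect}(1),\mathfrak{aff}(1);\mathrm{D}_{\lambda,\mu})\simeq\begin{cases}\mathbb{R}&\text{if }\mu-\lambda\in\{2,3,4\},\\ \mathbb{R}&\text{if }\lambda=0\text{ and }\mu=1,\\ \mathbb{R}&\text{if }\lambda\in\{0,-4\}\text{ and }\mu-\lambda=5,\\ \mathbb{R}&\text{if }\lambda=-\frac{5\pm\sqrt{19}}{2}\text{ and }\mu-\lambda=6,\\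 0&\text{otherwise.}\end{cases}$$ Moreover, in the nonzero cases the cohomology space is generated by the class of the following cocycle $C_{\lambda,\mu}$, where $C_{\lambda,\mu}(X\frac{d}{dx})(f\,dx^\lambda)=C_{\lambda,\mu}(X,f)\,dx^{\mu}$ and $\lambda\in\mathbb{R}$ is arbitrary in the second, third and fourth lines: $$\begin{aligned} C_{0,1}(X,f)&=X''f,\\ C_{\lambda,\lambda+2}(X,f)&=X^{(3)}f+2X''f',\\ C_{\lambda,\lambda+3}(X,f)&=X^{(3)}f'+X''f'',\\ C_{\lambda,\lambda+4}(X,f)&=-\lambda X^{(5)}f+X^{(4)}f'-6X^{(3)}f''-4X''f^{(3)},\\ C_{0,5}(X,f)&=2X^{(5)}f'-5X^{(4)}f''+10X^{(3)}f^{(3)}+5X''f^{(4)},\\ C_{-4,1}(X,f)&=12X^{(6)}f+22X^{(5)}f'+5X^{(4)}f''-10X^{(3)}f^{(3)}-5X''f^{(4)},\\ C_{a_i,a_i+6}(X,f)&=\alpha_iX^{(7)}f-\beta_iX^{(6)}f'-\gamma_iX^{(5)}f''-5X^{(4)}f^{(3)}+5X^{(3)}f^{(4)}+2X''f^{(5)}\quad(i=1,2),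 \end{aligned}$$ where $$\begin{aligned} a_1&=-\tfrac{5+\sqrt{19}}{2},&\alpha_1&=-\tfrac{22+5\sqrt{19}}{4},&\beta_1&=\tfrac{31+7\sqrt{19}}{2},&\gamma_1&=\tfrac{25+7\sqrt{19}}{2},\\ a_2&=-\tfrac{5-\sqrt{19}}{2},&\alpha_2&=-\tfrac{22-5\sqrt{19}}{4},&\beta_2&=\tfrac{31-7\sqrt{19}}{2},&\gamma_2&=\tfrac{25-7\sqrt{19}}{2}. \end{aligned}$$ -/

import Mathlib

open Polynomial

namespace AffCohomology

section RelativeCochains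

variable (R : Type*) [CommRing R] {L : Type*} [LieRing L] [LieAlgebra R L]
  (h : LieSubalgebra R L)
  (V : Type*) [AddCommGroup V] [Module R V] [LieRingModule L V] [LieModule R L V]

/-- The `h`-relative `0`-cochains of `L` with values in `V`: the invariants `V^h`. -/
def relZeroCochain : Submodule R V where
  carrier := {v | ∀ x ∈ h, ⁅x, v⁆ = 0}
  add_mem' ha hb x hx := by simp [ha x hx, hb x hx]
  zero_mem' := by simp
  smul_mem' t v hv x hx := by simp [hv x hx]

/-- The `h`-relative `1`-cochains `Hom_h(L/h; V)`: the linear maps on `L` that factor through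
`L/h` (that is, vanish on `h`) and commute with the action of `h`. -/
def relOneCochain : Submodule R (L →ₗ[R] V) where
  carrier := {c | (∀ x ∈ h, c x = 0) ∧ ∀ x ∈ h, ∀ y, c ⁅x, y⁆ = ⁅x, c y⁆}
  add_mem' ha hb :=
    ⟨fun x hx => by simp [ha.1 x hx, hb.1 x hx],
      fun x hx y => by simp [ha.2 x hx y, hb.2 x hx y]⟩
  zero_mem' := by simp
  smul_mem' t c hc := ⟨fun x hx => by simp [hc.1 x hx], fun x hx y => by simp [hc.2 x hx y]⟩

/-- The coboundary operator in degree `0`: `(δ v)(x) = x · v`. -/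
def d₀₁ : V →ₗ[R] (L →ₗ[R] V) :=
  (LieModule.toEnd R L V : L →ₗ[R] Module.End R V).flip

@[simp] lemma d₀₁_apply (v : V) (x : L) : d₀₁ R V v x = ⁅x, v⁆ := rfl

variable (S : Submodule R (L →ₗ[R] V))

/-- The `h`-relative `1`-cocycles that lie in a given space `S` of cochains. -/
def relOneCocycle : Submodule R (L →ₗ[R] V) :=
  relOneCochain R h V ⊓ S ⊓ LinearMap.ker (LieModule.Cohomology.d₁₂ R L V)

/-- The `h`-relative `1`-coboundaries: the image of `V^h` under `δ`. -/
def relOneCoboundary : Submodule R (L →ₗ[R] V) :=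
  (relZeroCochain R h V).map (d₀₁ R V)

/-- The first `h`-relative cohomology space of `L` with values in `V`, computed with the
`1`-cochains in `S`: cocycles modulo coboundaries. -/
def RelH1 : Type _ :=
  relOneCocycle R h V S ⧸ (relOneCoboundary R h V).submoduleOf (relOneCocycle R h V S)

instance : AddCommGroup (RelH1 R h V S) :=
  inferInstanceAs (AddCommGroup
    (relOneCocycle R h V S ⧸ (relOneCoboundary R h V).submoduleOf (relOneCocycle R h V S)))

instance : Module R (RelH1 R h V S) :=
  inferInstanceAs (Module R
    (relOneCocycle R h V S ⧸ (relOneCoboundary R h V).submoduleOf (relOneCocycle R h V S)))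

/-- The cohomology class of a cocycle. -/
def RelH1.mk : relOneCocycle R h V S →ₗ[R] RelH1 R h V S :=
  ((relOneCoboundary R h V).submoduleOf (relOneCocycle R h V S)).mkQ

end RelativeCochains

/-- `vect(1)`: polynomial vector fields on the line, that is, derivations of `ℝ[x]`,
with the commutator bracket. -/
abbrev Vect : Type := Derivation ℝ ℝ[X] ℝ[X]

/-- The coefficient `g` of the vector field `g d/dx`. -/
noncomputable def coef (D : Vect) : ℝ[X] := D X

/-- The vector field `g d/dx`. -/
noncomputable def field (g : ℝ[X]) : Vect := mkDerivation ℝ g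

@[simp] lemma coef_field (g : ℝ[X]) : coef (field g) = g := by simp [coef, field]

@[simp] lemma coef_add (D E : Vect) : coef (D + E) = coef D + coef E := rfl

@[simp] lemma coef_smul (t : ℝ) (D : Vect) : coef (t • D) = t • coef D := rfl

lemma apply_eq (D : Vect) (f : ℝ[X]) : D f = coef D * derivative f := by
  have h : D = mkDerivation ℝ (D X) := derivation_ext (by simp)
  rw [h, mkDerivation_apply, smul_eq_mul, mul_comm]
  simp [coef]

@[simp] lemma coef_lie (D E : Vect) :
    coef ⁅D, E⁆ = coef D * derivative (coef E) - coef E * derivative (coef D) := by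
  change D (E X) - E (D X) = _
  rw [apply_eq D (E X), apply_eq E (D X)]
  rfl

/-- `aff(1)`: the Lie subalgebra of `vect(1)` generated by `d/dx` and `x d/dx`. -/
noncomputable def aff : LieSubalgebra ℝ Vect :=
  LieSubalgebra.lieSpan ℝ Vect {field 1, field X}

/-- The space `F_l` of polynomial densities `f dx^l` of weight `l`; `f dx^l` is written `f`. -/
def Density (_l : ℝ) : Type := ℝ[X]

noncomputable instance (l : ℝ) : AddCommGroup (Density l) := inferInstanceAs (AddCommGroup ℝ[X])

noncomputable instance (l : ℝ) : Module ℝ (Density l) := inferInstanceAs (Module ℝ ℝ[X])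

/-- The density `f dx^l`. -/
noncomputable def dens (l : ℝ) : ℝ[X] ≃ₗ[ℝ] Density l := LinearEquiv.refl ℝ ℝ[X]

/-- The Lie derivative `L^l_{g d/dx} f = g f' + l g' f`. -/
noncomputable instance (l : ℝ) : Bracket Vect (Density l) where
  bracket D f := dens l (coef D * derivative ((dens l).symm f)
    + C l * derivative (coef D) * (dens l).symm f)

lemma lie_dens (l : ℝ) (D : Vect) (f : ℝ[X]) :
    ⁅D, dens l f⁆ = dens l (coef D * derivative f + C l * derivative (coef D) * f) := by
  simp [Bracket.bracket]

noncomputable instance (l : ℝ) : LieRingModule Vect (Density l) where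
  add_lie D E f := by
    obtain ⟨f, rfl⟩ := (dens l).surjective f
    simp only [lie_dens, ← map_add, coef_add]
    congr 1
    rw [map_add]
    ring
  lie_add D f g := by
    obtain ⟨f, rfl⟩ := (dens l).surjective f
    obtain ⟨g, rfl⟩ := (dens l).surjective g
    simp only [lie_dens, ← map_add]
    congr 1
    rw [map_add]
    ring
  leibniz_lie D E f := by
    obtain ⟨f, rfl⟩ := (dens l).surjective f
    simp only [lie_dens, ← map_add, coef_lie]
    congr 1
    simp only [map_add, map_sub, derivative_mul, derivative_C]
    ring

noncomputable instance (l : ℝ) : LieModule ℝ Vect (Density l) where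
  smul_lie t D f := by
    obtain ⟨f, rfl⟩ := (dens l).surjective f
    simp only [lie_dens, ← map_smul, coef_smul]
    congr 1
    simp only [smul_eq_C_mul, derivative_C_mul]
    ring
  lie_smul t D f := by
    obtain ⟨f, rfl⟩ := (dens l).surjective f
    rw [← map_smul]
    simp only [lie_dens, ← map_smul]
    congr 1
    simp only [smul_eq_C_mul, derivative_C_mul]
    ring

/-- A linear map `F_l → F_m` is a differential operator if it has the form
`f ↦ ∑ k, a_k f^(k)`, a finite sum with polynomial coefficients `a_k`. -/
def IsDiffOp {l m : ℝ} (A : Density l →ₗ[ℝ] Density m) : Prop :=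
  ∃ a : ℕ →₀ ℝ[X], ∀ f : ℝ[X],
    A (dens l f) = dens m (a.sum fun k p => p * derivative^[k] f)

section Closure

variable {l m : ℝ}

lemma IsDiffOp.add {A B : Density l →ₗ[ℝ] Density m} (hA : IsDiffOp A) (hB : IsDiffOp B) :
    IsDiffOp (A + B) := by
  obtain ⟨a, ha⟩ := hA
  obtain ⟨b, hb⟩ := hB
  refine ⟨a + b, fun f => ?_⟩
  rw [LinearMap.add_apply, ha, hb, ← map_add]
  congr 1
  rw [Finsupp.sum_add_index'] <;> simp [add_mul]

lemma IsDiffOp.zero : IsDiffOp (0 : Density l →ₗ[ℝ] Density m) := ⟨0, fun f => by simp⟩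

lemma IsDiffOp.smul (t : ℝ) {A : Density l →ₗ[ℝ] Density m} (hA : IsDiffOp A) :
    IsDiffOp (t • A) := by
  obtain ⟨a, ha⟩ := hA
  refine ⟨a.mapRange (fun p => t • p) (by simp), fun f => ?_⟩
  rw [LinearMap.smul_apply, ha, ← map_smul, Finsupp.sum_mapRange_index (by simp)]
  simp [Finsupp.sum, Finset.smul_sum]

/-- The operator `f ↦ p f^(k)`. -/
noncomputable def monoOp (l m : ℝ) (k : ℕ) (p : ℝ[X]) : Density l →ₗ[ℝ] Density m :=
  (dens m).toLinearMap ∘ₗ LinearMap.mulLeft ℝ p ∘ₗ (derivative (R := ℝ) ^ k) ∘ₗ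
    (dens l).symm.toLinearMap

lemma monoOp_apply (k : ℕ) (p f : ℝ[X]) :
    monoOp l m k p (dens l f) = dens m (p * derivative^[k] f) := by
  simp [monoOp, Module.End.pow_apply]

lemma isDiffOp_monoOp (k : ℕ) (p : ℝ[X]) : IsDiffOp (monoOp l m k p) :=
  ⟨Finsupp.single k p, fun f => by simp [monoOp_apply]⟩

lemma IsDiffOp.eq_sum {A : Density l →ₗ[ℝ] Density m} (hA : IsDiffOp A) :
    ∃ a : ℕ →₀ ℝ[X], A = ∑ k ∈ a.support, monoOp l m k (a k) := by
  obtain ⟨a, ha⟩ := hA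
  refine ⟨a, LinearMap.ext fun f => ?_⟩
  obtain ⟨f, rfl⟩ := (dens l).surjective f
  simp [ha, monoOp_apply, Finsupp.sum]

lemma IsDiffOp.sum {ι : Type*} (s : Finset ι) (A : ι → Density l →ₗ[ℝ] Density m)
    (hA : ∀ i ∈ s, IsDiffOp (A i)) : IsDiffOp (∑ i ∈ s, A i) :=
  Finset.sum_induction A IsDiffOp (fun _ _ => IsDiffOp.add) IsDiffOp.zero hA

lemma isDiffOp_lie_monoOp (D : Vect) (k : ℕ) (p : ℝ[X]) : IsDiffOp ⁅D, monoOp l m k p⁆ := by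
  have key : ⁅D, monoOp l m k p⁆ =
      monoOp l m k (coef D * derivative p + C m * derivative (coef D) * p)
      + monoOp l m (k + 1) (coef D * p)
      + (-1 : ℝ) • (∑ i ∈ Finset.range (k + 1),
          (monoOp l m (i + 1) (p * (k.choose i • derivative^[k - i] (coef D)))
          + monoOp l m i (p * (C l * (k.choose i • derivative^[k - i + 1] (coef D)))))) := by
    refine LinearMap.ext fun f => ?_
    obtain ⟨f, rfl⟩ := (dens l).surjective f
    simp only [LieHom.lie_apply, lie_dens, monoOp_apply, LinearMap.add_apply,
      LinearMap.smul_apply, LinearMap.sum_apply, ← map_add, ← map_sum, ← map_smul, ← map_sub]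
    congr 1
    have h1 : derivative^[k] (coef D * derivative f + C l * derivative (coef D) * f)
        = ∑ i ∈ Finset.range (k + 1),
          ((k.choose i • derivative^[k - i] (coef D)) * derivative^[i + 1] f
          + (C l * (k.choose i • derivative^[k - i + 1] (coef D))) * derivative^[i] f) := by
      rw [iterate_map_add, mul_assoc, iterate_derivative_C_mul, iterate_derivative_mul,
        iterate_derivative_mul, Finset.mul_sum, ← Finset.sum_add_distrib]
      refine Finset.sum_congr rfl fun i _ => ?_
      simp only [← Function.iterate_succ_apply, nsmul_eq_mul]
      ring
    rw [h1, Finset.mul_sum, derivative_mul, ← Function.iterate_succ_apply' derivative k f,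
      neg_one_smul, ← sub_eq_add_neg]
    congr 1
    · ring
    · refine Finset.sum_congr rfl fun i _ => ?_
      ring
  rw [key]
  exact ((isDiffOp_monoOp _ _).add (isDiffOp_monoOp _ _)).add
    (IsDiffOp.smul _ (IsDiffOp.sum _ _ fun i _ => (isDiffOp_monoOp _ _).add (isDiffOp_monoOp _ _)))

lemma IsDiffOp.lie (D : Vect) {A : Density l →ₗ[ℝ] Density m} (hA : IsDiffOp A) :
    IsDiffOp ⁅D, A⁆ := by
  obtain ⟨a, rfl⟩ := hA.eq_sum
  rw [lie_sum]
  exact IsDiffOp.sum _ _ fun k _ => isDiffOp_lie_monoOp D k _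

end Closure

/-- The `vect(1)`-module `D_{l,m}` of differential operators `F_l → F_m`, with the action
`D · A = L^m_D ∘ A - A ∘ L^l_D` (the bracket of `Hom(F_l, F_m)`). -/
noncomputable def DiffOp (l m : ℝ) : LieSubmodule ℝ Vect (Density l →ₗ[ℝ] Density m) where
  carrier := {A | IsDiffOp A}
  add_mem' := IsDiffOp.add
  zero_mem' := IsDiffOp.zero
  smul_mem' t _ := IsDiffOp.smul t
  lie_mem := IsDiffOp.lie _

/-- The value on `g d/dx` and `f dx^l` of a `1`-cochain with values in `D_{l,m}`: the
coefficient of the resulting density. -/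
noncomputable def bilin {l m : ℝ} (c : Vect →ₗ[ℝ] DiffOp l m) (g f : ℝ[X]) : ℝ[X] :=
  (dens m).symm ((c (field g)).1 (dens l f))

/-- The `1`-cochains that are given by (bi)differential operators
`(g, f) ↦ ∑ (i, j), a_ij g^(i) f^(j)`, a finite sum with polynomial coefficients. -/
noncomputable def diffCochain (l m : ℝ) : Submodule ℝ (Vect →ₗ[ℝ] DiffOp l m) where
  carrier := {c | ∃ a : ℕ × ℕ →₀ ℝ[X], ∀ g f : ℝ[X],
    bilin c g f = a.sum fun ij p => p * derivative^[ij.1] g * derivative^[ij.2] f}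
  add_mem' := by
    rintro c d ⟨a, ha⟩ ⟨b, hb⟩
    refine ⟨a + b, fun g f => ?_⟩
    rw [Finsupp.sum_add_index' (by simp) (by intros; ring), ← ha, ← hb]
    simp [bilin]
  zero_mem' := ⟨0, by simp [bilin]⟩
  smul_mem' := by
    rintro t c ⟨a, ha⟩
    refine ⟨a.mapRange (fun p => t • p) (by simp), fun g f => ?_⟩
    rw [Finsupp.sum_mapRange_index (by simp)]
    have h : bilin (t • c) g f = t • bilin c g f := by simp [bilin]
    rw [h, ha]
    simp [Finsupp.sum, Finset.smul_sum]

/-- The space `Z¹_diff(vect(1), aff(1); D_{l,m})` of differential relative `1`-cocycles. -/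
noncomputable abbrev Z1 (l m : ℝ) : Submodule ℝ (Vect →ₗ[ℝ] DiffOp l m) :=
  relOneCocycle ℝ aff (DiffOp l m) (diffCochain l m)

/-- The cohomology space `H¹_diff(vect(1), aff(1); D_{l,m})`. -/
abbrev H1 (l m : ℝ) : Type := RelH1 ℝ aff (DiffOp l m) (diffCochain l m)

/-- The bilinear operator `P` is a relative differential `1`-cocycle whose cohomology class
generates `H¹_diff(vect(1), aff(1); D_{l,m})`. -/
def Generates (l m : ℝ) (P : ℝ[X] → ℝ[X] → ℝ[X]) : Prop :=
  ∃ c : Z1 l m, (∀ g f : ℝ[X], bilin c.1 g f = P g f) ∧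
    Submodule.span ℝ {RelH1.mk ℝ aff (DiffOp l m) (diffCochain l m) c} = ⊤

/-- The pairs of weights for which the cohomology is nonzero. -/
def Resonant (l m : ℝ) : Prop :=
  (m - l = 2 ∨ m - l = 3 ∨ m - l = 4) ∨
  (l = 0 ∧ m = 1) ∨
  ((l = 0 ∨ l = -4) ∧ m - l = 5) ∨
  ((l = -(5 + √19) / 2 ∨ l = -(5 - √19) / 2) ∧ m - l = 6)

/-- The `k`-th derivative of a polynomial. -/
noncomputable abbrev dd (k : ℕ) (p : ℝ[X]) : ℝ[X] := derivative^[k] p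

end AffCohomology

open AffCohomology

/-! Put n = μ − λ. Equivariance under d/dx makes a relative cochain constant-coefficient, so it is
determined by its symbols, the constant terms of its values on pairs (X^a, X^b). Equivariance under
x d/dx kills the symbols with a + b ≠ n + 1, and vanishing on aff(1) kills those with a < 2.

The cocycle condition on X² and X^(b+2) computes the symbol at b + 3 from those at 2 and b + 2. A
cocycle is therefore determined by its symbols at a = 2 and a = 3 (`eq_zero_of_symb_two_three`). For
n = r + 2 the coboundary of a multiple of f ↦ f^(n) has leading symbols proportional to (r + 1 + 2λ,
r + 3λ), which is never zero. So a 2 × 2 determinant decides whether a cocycle is a coboundary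
(`isCoboundary_of_det`, `det_of_isCoboundary`), and the cohomology is at most a line. In weight n =
1 there is a single symbol, and coboundaries reach it exactly when λ ≠ 0.

From n = 5 on, the pair (X³, X⁴) recomputes a known symbol. Consistency says that a quadratic in λ
times the determinant is zero (`det_obstruction`); its roots are 0, −4 for n = 5 and −(5 ± √19)/2
for n = 6. From n = 7 on, the pair (X⁴, X⁵) excludes the roots too (`det_obstruction'`). In the
remaining weights the explicit cocycles have nonzero determinant, or nonzero symbol when n = 1,
hence generate (`generates_of_det`, `generates_zero_one`). -/

namespace AffCohomology

/-! ### Relative cocycles of a general Lie algebra. -/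

section General

variable {R : Type*} [CommRing R] {L : Type*} [LieRing L] [LieAlgebra R L]
  {V : Type*} [AddCommGroup V] [Module R V] [LieRingModule L V] [LieModule R L V]

lemma d₁₂_eq_zero_iff (c : L →ₗ[R] V) :
    c ∈ LinearMap.ker (LieModule.Cohomology.d₁₂ R L V) ↔
      ∀ x y, c ⁅x, y⁆ = ⁅x, c y⁆ - ⁅y, c x⁆ := by
  rw [LinearMap.mem_ker]
  constructor
  · intro h x y
    have := LieModule.Cohomology.d₁₂_apply_apply R L V c x y
    rw [h] at this
    exact (sub_eq_zero.1 this.symm).symm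
  · intro h
    ext x y
    change LieModule.Cohomology.d₁₂ R L V c x y = 0
    rw [LieModule.Cohomology.d₁₂_apply_apply, h, sub_self]

/-- A cocycle that vanishes on generators of a subalgebra is a relative cochain. -/
lemma mem_relOneCochain_lieSpan {s : Set L} {c : L →ₗ[R] V}
    (hc : ∀ x y, c ⁅x, y⁆ = ⁅x, c y⁆ - ⁅y, c x⁆) (hs : ∀ x ∈ s, c x = 0) :
    c ∈ relOneCochain R (LieSubalgebra.lieSpan R L s) V := by
  -- By the cocycle identity the kernel of `c` is closed under the bracket, so it contains the
  -- subalgebra generated by `s`.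
  let K : LieSubalgebra R L :=
    { LinearMap.ker c with
      lie_mem' := fun {x y} hx hy => by
        have hx' : c x = 0 := hx
        have hy' : c y = 0 := hy
        change c ⁅x, y⁆ = 0
        rw [hc, hx', hy', lie_zero, lie_zero, sub_zero] }
  have hK : LieSubalgebra.lieSpan R L s ≤ K := LieSubalgebra.lieSpan_le.2 hs
  have h0 : ∀ x ∈ LieSubalgebra.lieSpan R L s, c x = 0 := fun x hx => hK hx
  exact ⟨h0, fun x hx y => by rw [hc, h0 x hx, lie_zero, sub_zero]⟩

/-- The annihilator of `v` is the kernel of the cocycle `d₀₁ R V v`, so generators suffice here as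
well. -/
lemma mem_relZeroCochain_lieSpan {s : Set L} {v : V} (hs : ∀ x ∈ s, ⁅x, v⁆ = 0) :
    v ∈ relZeroCochain R (LieSubalgebra.lieSpan R L s) V := by
  have := mem_relOneCochain_lieSpan (R := R) (s := s) (c := d₀₁ R V v)
    (fun x y => by simp) (by simpa using hs)
  exact this.1

lemma d₀₁_isCocycle (v : V) (x y : L) :
    d₀₁ R V v ⁅x, y⁆ = ⁅x, d₀₁ R V v y⁆ - ⁅y, d₀₁ R V v x⁆ := by simp

lemma d₀₁_mem_relOneCochain {h : LieSubalgebra R L} {v : V} (hv : v ∈ relZeroCochain R h V) :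
    d₀₁ R V v ∈ relOneCochain R h V :=
  ⟨fun x hx => hv x hx, fun x hx y => by
    rw [d₀₁_isCocycle, show d₀₁ R V v x = 0 from hv x hx, lie_zero, sub_zero]⟩

lemma RelH1.mk_eq_zero_iff {h : LieSubalgebra R L} {S : Submodule R (L →ₗ[R] V)}
    (c : relOneCocycle R h V S) :
    RelH1.mk R h V S c = 0 ↔ ∃ v ∈ relZeroCochain R h V, d₀₁ R V v = (c : L →ₗ[R] V) :=
  (Submodule.Quotient.mk_eq_zero _).trans Iff.rfl

lemma RelH1.mk_surjective {h : LieSubalgebra R L} {S : Submodule R (L →ₗ[R] V)} :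
    Function.Surjective (RelH1.mk R h V S) := Submodule.mkQ_surjective _

end General

/-! ### Cochains as bilinear operators on polynomials. -/

lemma field_add (g h : ℝ[X]) : field (g + h) = field g + field h := by
  apply derivation_ext; simp [field]

lemma field_smul (t : ℝ) (g : ℝ[X]) : field (t • g) = t • field g := by
  apply derivation_ext; simp [field]

lemma field_coef (D : Vect) : field (coef D) = D := by
  apply derivation_ext; simp [field, coef]

lemma lie_field (g h : ℝ[X]) :
    ⁅field g, field h⁆ = field (g * derivative h - h * derivative g) := by
  rw [← field_coef ⁅field g, field h⁆]; simp

variable {l m : ℝ}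

/-- The bilinear operator of a cochain as a bilinear map. -/
noncomputable def bilinMap (c : Vect →ₗ[ℝ] DiffOp l m) : ℝ[X] →ₗ[ℝ] ℝ[X] →ₗ[ℝ] ℝ[X] :=
  LinearMap.mk₂ ℝ (bilin c)
    (fun g h f => by simp [bilin, field_add])
    (fun t g f => by simp [bilin, field_smul])
    (fun g f f' => by simp [bilin])
    (fun t g f => by simp [bilin])

lemma bilinMap_apply (c : Vect →ₗ[ℝ] DiffOp l m) (g f : ℝ[X]) :
    bilinMap c g f = bilin c g f := rfl

lemma bilin_spec (c : Vect →ₗ[ℝ] DiffOp l m) (g f : ℝ[X]) :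
    (c (field g)).1 (dens l f) = dens m (bilin c g f) := by simp [bilin]

lemma DiffOp.ext {A B : DiffOp l m} (h : ∀ f : ℝ[X], A.1 (dens l f) = B.1 (dens l f)) :
    A = B := by
  apply Subtype.ext
  apply LinearMap.ext
  intro f
  obtain ⟨f, rfl⟩ := (dens l).surjective f
  exact h f

lemma bilin_ext {c d : Vect →ₗ[ℝ] DiffOp l m} (h : ∀ g f, bilin c g f = bilin d g f) :
    c = d := by
  refine LinearMap.ext fun D => DiffOp.ext fun f => ?_
  rw [← field_coef D, bilin_spec, bilin_spec, h]

/-- The coefficient of the action of `g d/dx` on an operator. -/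
lemma lie_diffOp_apply (A : DiffOp l m) (g f : ℝ[X]) :
    (⁅field g, A⁆ : DiffOp l m).1 (dens l f) =
      ⁅field g, A.1 (dens l f)⁆ - A.1 ⁅field g, dens l f⁆ := by
  rw [LieSubmodule.coe_bracket, LieHom.lie_apply]

lemma lie_bilin_apply (c : Vect →ₗ[ℝ] DiffOp l m) (g h f : ℝ[X]) :
    (⁅field g, c (field h)⁆ : DiffOp l m).1 (dens l f) =
      dens m (g * derivative (bilin c h f) + C m * derivative g * bilin c h f
        - bilin c h (g * derivative f + C l * derivative g * f)) := by
  rw [lie_diffOp_apply, bilin_spec, lie_dens, lie_dens, bilin_spec, coef_field, map_sub]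

/-- The cocycle condition in terms of the bilinear operator. -/
lemma isCocycle_iff (c : Vect →ₗ[ℝ] DiffOp l m) :
    (∀ x y, c ⁅x, y⁆ = ⁅x, c y⁆ - ⁅y, c x⁆) ↔
      ∀ g h f : ℝ[X], bilin c (g * derivative h - h * derivative g) f =
        (g * derivative (bilin c h f) + C m * derivative g * bilin c h f
          - bilin c h (g * derivative f + C l * derivative g * f))
        - (h * derivative (bilin c g f) + C m * derivative h * bilin c g f
          - bilin c g (h * derivative f + C l * derivative h * f)) := by
  constructor
  · intro hc g h f
    have h1 := congrArg (fun A : DiffOp l m => A.1 (dens l f)) (hc (field g) (field h))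
    simp only [lie_field, bilin_spec] at h1
    apply (dens m).injective
    rw [h1, map_sub, ← lie_bilin_apply, ← lie_bilin_apply]
    rfl
  · intro hc x y
    refine DiffOp.ext fun f => ?_
    rw [← field_coef x, ← field_coef y, lie_field, bilin_spec, hc, map_sub, ← lie_bilin_apply,
      ← lie_bilin_apply]
    rfl

lemma field_one_mem_aff : field 1 ∈ aff := LieSubalgebra.subset_lieSpan (by simp)

lemma field_X_mem_aff : field X ∈ aff := LieSubalgebra.subset_lieSpan (by simp)

/-! ### Symbols of relative cochains and the recursion between them. -/

section Cochain

variable {c : Vect →ₗ[ℝ] DiffOp l m}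

lemma bilin_equivariant (hc : c ∈ relOneCochain ℝ aff (DiffOp l m)) {g : ℝ[X]}
    (hg : field g ∈ aff) (h f : ℝ[X]) :
    bilin c (g * derivative h - h * derivative g) f =
      g * derivative (bilin c h f) + C m * derivative g * bilin c h f
        - bilin c h (g * derivative f + C l * derivative g * f) := by
  have h1 := congrArg (fun A : DiffOp l m => A.1 (dens l f)) (hc.2 _ hg (field h))
  simp only [lie_field, bilin_spec, lie_bilin_apply] at h1
  exact (dens m).injective h1

lemma bilin_aff (hc : c ∈ relOneCochain ℝ aff (DiffOp l m)) {g : ℝ[X]}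
    (hg : field g ∈ aff) (f : ℝ[X]) : bilin c g f = 0 := by
  simp [bilin, hc.1 _ hg]

/-- This is equivariance under d/dx; it expresses that the bilinear operator has constant
coefficients. -/
lemma derivative_bilin (hc : c ∈ relOneCochain ℝ aff (DiffOp l m)) (g f : ℝ[X]) :
    derivative (bilin c g f) = bilin c (derivative g) f + bilin c g (derivative f) := by
  have h := bilin_equivariant hc field_one_mem_aff g f
  simp only [derivative_one, one_mul, mul_zero, zero_mul, sub_zero, add_zero] at h
  rw [h]; ring

/-- The value at `0` of the operator of a cochain on monomials. -/
noncomputable def symb (c : Vect →ₗ[ℝ] DiffOp l m) (a b : ℕ) : ℝ :=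
  (bilin c (X ^ a) (X ^ b)).eval 0

lemma symb_smul (t : ℝ) (c : Vect →ₗ[ℝ] DiffOp l m) (a b : ℕ) :
    symb (t • c) a b = t * symb c a b := by simp [symb, bilin]

lemma symb_sub (c d : Vect →ₗ[ℝ] DiffOp l m) (a b : ℕ) :
    symb (c - d) a b = symb c a b - symb d a b := by simp [symb, bilin]

/-- Zero symbols make every value vanish at 0 by bilinearity. The Leibniz rule `derivative_bilin`
spreads this to all derivatives at 0, hence to all coefficients. -/
lemma eq_zero_of_symb (hc : c ∈ relOneCochain ℝ aff (DiffOp l m))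
    (h : ∀ a b, symb c a b = 0) : c = 0 := by
  have h0 : ∀ g f : ℝ[X], (bilin c g f).eval 0 = 0 := by
    intro g f
    have : (bilinMap c).compr₂ (leval 0 : ℝ[X] →ₗ[ℝ] ℝ) = 0 := by
      refine Polynomial.lhom_ext' fun a => LinearMap.ext_ring (Polynomial.lhom_ext' fun b =>
        LinearMap.ext_ring ?_)
      simpa [symb, bilinMap_apply, monomial_one_right_eq_X_pow] using h a b
    simpa [bilinMap_apply] using LinearMap.congr_fun (LinearMap.congr_fun this g) f
  have h1 : ∀ k, ∀ g f : ℝ[X], (derivative^[k] (bilin c g f)).eval 0 = 0 := by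
    intro k
    induction k with
    | zero => exact h0
    | succ k ih =>
      intro g f
      rw [Function.iterate_succ_apply, derivative_bilin hc, iterate_map_add, eval_add, ih, ih,
        add_zero]
  refine bilin_ext fun g f => ?_
  have : bilin (0 : Vect →ₗ[ℝ] DiffOp l m) g f = 0 := by simp [bilin]
  rw [this]
  ext k
  have h2 := h1 k g f
  rw [← coeff_zero_eq_eval_zero, coeff_iterate_derivative] at h2
  simpa [Nat.descFactorial_self, Nat.factorial_ne_zero] using h2

/-- Monomials are eigenvectors of x d/dx, and at 0 the term with coefficient X drops out, so
equivariance compares eigenvalues. -/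
lemma symb_weight (hc : c ∈ relOneCochain ℝ aff (DiffOp l m)) (a b : ℕ) :
    ((a : ℝ) + b - 1 - (m - l)) * symb c a b = 0 := by
  have h := congrArg (eval 0) (bilin_equivariant hc field_X_mem_aff (X ^ a) (X ^ b))
  have h1 : ∀ k : ℕ, (X : ℝ[X]) * derivative (X ^ k) = (k : ℝ) • X ^ k := by
    intro k
    cases k with
    | zero => simp
    | succ k => rw [derivative_X_pow, smul_eq_C_mul, Nat.add_sub_cancel]; ring
  have h2 : bilin c (X * derivative (X ^ a) - X ^ a * derivative X) (X ^ b)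
      = ((a : ℝ) - 1) • bilin c (X ^ a) (X ^ b) := by
    rw [h1, derivative_X, mul_one, ← bilinMap_apply, ← bilinMap_apply, map_sub, map_smul,
      LinearMap.sub_apply, LinearMap.smul_apply, sub_smul, one_smul]
  have h3 : bilin c (X ^ a) (X * derivative (X ^ b) + C l * derivative X * X ^ b)
      = ((b : ℝ) + l) • bilin c (X ^ a) (X ^ b) := by
    rw [h1, derivative_X, mul_one, ← smul_eq_C_mul, ← add_smul, ← bilinMap_apply,
      ← bilinMap_apply, map_smul]
  rw [h2, h3] at h
  simp at h
  simp only [symb]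
  linarith

lemma symb_lt_two (hc : c ∈ relOneCochain ℝ aff (DiffOp l m)) {a : ℕ} (ha : a < 2) (b : ℕ) :
    symb c a b = 0 := by
  interval_cases a
  · simp [symb, bilin_aff hc field_one_mem_aff]
  · simp [symb, bilin_aff hc field_X_mem_aff]

/-- Starting the exponents at 2 avoids truncated subtraction and loses nothing, since relative
cochains vanish on 1 and X. -/
lemma lie_X_pow (l : ℝ) (a k : ℕ) : (X : ℝ[X]) ^ (a + 2) * derivative (X ^ k)
      + C l * derivative (X ^ (a + 2)) * X ^ k = ((k : ℝ) + l * (a + 2)) • X ^ (a + k + 1) := by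
  rcases k with _ | k <;>
  · simp only [derivative_X_pow, smul_eq_C_mul, map_add, map_mul, Nat.cast_add, map_ofNat,
      Nat.add_succ_sub_one, C_eq_natCast, Nat.cast_ofNat, pow_zero, derivative_one, Nat.cast_zero, map_zero]
    push_cast
    ring

/-- The cocycle condition on symbols. -/
lemma symb_cocycle (hc : ∀ x y, c ⁅x, y⁆ = ⁅x, c y⁆ - ⁅y, c x⁆) (a b k : ℕ) :
    ((b : ℝ) - a) * symb c (a + b + 3) k =
      (k + l * (b + 2)) * symb c (a + 2) (b + k + 1)
        - (k + l * (a + 2)) * symb c (b + 2) (a + k + 1) := by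
  have h := congrArg (eval 0) ((isCocycle_iff c).1 hc (X ^ (a + 2)) (X ^ (b + 2)) (X ^ k))
  have h1 : (X : ℝ[X]) ^ (a + 2) * derivative (X ^ (b + 2))
      - X ^ (b + 2) * derivative (X ^ (a + 2)) = ((b : ℝ) - a) • X ^ (a + b + 3) := by
    simp only [derivative_X_pow, smul_eq_C_mul, map_sub, Nat.cast_add, map_add]
    simp only [C_eq_natCast, Nat.add_succ_sub_one]
    push_cast
    ring
  rw [h1, lie_X_pow, lie_X_pow] at h
  simp only [← bilinMap_apply, map_smul, LinearMap.smul_apply] at h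
  simp [bilinMap_apply] at h
  simp only [symb]
  linarith

end Cochain

/-- A relative cocycle is determined by its two leading symbols. -/
lemma eq_zero_of_symb_two_three {c : Vect →ₗ[ℝ] DiffOp l m}
    (hc : c ∈ relOneCochain ℝ aff (DiffOp l m))
    (hd : ∀ x y, c ⁅x, y⁆ = ⁅x, c y⁆ - ⁅y, c x⁆)
    (h2 : ∀ k, symb c 2 k = 0) (h3 : ∀ k, symb c 3 k = 0) : c = 0 := by
  have h : ∀ p k, symb c (p + 3) k = 0 := by
    intro p
    induction p with
    | zero => exact h3
    | succ p ih =>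
      intro k
      -- Bracketing with X² raises the first index by one, with factor p + 1 ≠ 0. Bracketing X² with
      -- itself gives factor 0, so index 3 cannot be reached from index 2 and must be assumed.
      have := symb_cocycle hd 0 (p + 1) k
      rw [h2, show p + 1 + 2 = p + 3 by ring, ih, mul_zero, mul_zero, sub_zero,
        show 0 + (p + 1) + 3 = p + 1 + 3 by ring] at this
      refine (mul_eq_zero.1 this).resolve_left ?_
      push_cast
      have : (0 : ℝ) ≤ p := p.cast_nonneg
      linarith
  refine eq_zero_of_symb hc fun a b => ?_
  rcases lt_or_ge a 2 with ha | ha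
  · exact symb_lt_two hc ha b
  · obtain ⟨p, rfl⟩ := Nat.exists_eq_add_of_le' ha
    cases p with
    | zero => exact h2 b
    | succ p => exact h p b

lemma symb_eq_zero_of_ne {c : Vect →ₗ[ℝ] DiffOp l m}
    (hc : c ∈ relOneCochain ℝ aff (DiffOp l m)) {n a b : ℕ} (hm : m = l + n)
    (h : a + b ≠ n + 1) : symb c a b = 0 := by
  refine (mul_eq_zero.1 (symb_weight hc a b)).resolve_left fun h0 => h ?_
  have : (a : ℝ) + b = n + 1 := by rw [hm] at h0; linarith
  exact_mod_cast this

/-! ### Coboundaries and the determinant criterion. -/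

/-- The symbol of a coboundary. -/
lemma symb_d₀₁ (v : DiffOp l m) (a b : ℕ) :
    symb (d₀₁ ℝ (DiffOp l m) v) (a + 2) b =
      -(b + l * (a + 2)) * ((dens m).symm (v.1 (dens l (X ^ (a + b + 1))))).eval 0 := by
  obtain ⟨g, hg⟩ := (dens m).surjective (v.1 (dens l (X ^ b)))
  rw [symb, bilin, d₀₁_apply, lie_diffOp_apply, lie_dens, coef_field, lie_X_pow, ← hg, lie_dens,
    map_smul, map_smul, map_sub, map_smul]
  simp
  ring

lemma exists_invariant (n : ℕ) (hm : m = l + n) :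
    ∃ v ∈ relZeroCochain ℝ aff (DiffOp l m), ∀ a b : ℕ, a + b + 1 = n →
      symb (d₀₁ ℝ (DiffOp l m) v) (a + 2) b = b + l * (a + 2) := by
  -- This multiple of the n-th derivative sends X^n to −1, which cancels the sign in `symb_d₀₁`.
  refine ⟨⟨monoOp l m n (C (-(n.factorial : ℝ)⁻¹)), isDiffOp_monoOp _ _⟩, ?_, ?_⟩
  · refine mem_relZeroCochain_lieSpan ?_
    rintro x (rfl | rfl)
    · refine DiffOp.ext fun f => ?_
      rw [lie_diffOp_apply, lie_dens, monoOp_apply, monoOp_apply, lie_dens]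
      simp only [coef_field, derivative_one, mul_zero, zero_mul, add_zero, one_mul,
        derivative_C_mul, ← map_sub, ← Function.iterate_succ_apply,
        ← Function.iterate_succ_apply' derivative]
      rw [sub_self]; rfl
    · refine DiffOp.ext fun f => ?_
      rw [lie_diffOp_apply, lie_dens, monoOp_apply, monoOp_apply, lie_dens, ← map_sub]
      refine ((dens m).map_eq_zero_iff).2 ?_
      rw [coef_field, mul_comm X (derivative f), iterate_map_add, derivative_X, mul_one (C l), mul_one,
        iterate_derivative_C_mul, iterate_derivative_derivative_mul_X, derivative_C_mul,
        ← Function.iterate_succ_apply' derivative, hm]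
      simp only [map_add, C_eq_natCast, nsmul_eq_mul]
      ring
  · intro a b h
    rw [symb_d₀₁, monoOp_apply, h]
    simp [iterate_derivative_X_pow_eq_smul, Nat.descFactorial_self]
    have := Nat.factorial_ne_zero n
    field_simp
    ring

lemma mem_relOneCocycle {c : Vect →ₗ[ℝ] DiffOp l m} :
    c ∈ Z1 l m ↔ c ∈ relOneCochain ℝ aff (DiffOp l m) ∧ c ∈ diffCochain l m ∧
      ∀ x y, c ⁅x, y⁆ = ⁅x, c y⁆ - ⁅y, c x⁆ := by
  rw [← d₁₂_eq_zero_iff]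
  exact and_assoc

/-- The determinant condition says that the leading symbols of `c` are proportional to those of the
standard coboundary. Subtracting that multiple leaves a cocycle with zero leading symbols, which is
zero. -/
lemma isCoboundary_of_det {c : Vect →ₗ[ℝ] DiffOp l m} {r : ℕ} (hm : m = l + (r + 2))
    (hc : c ∈ relOneCochain ℝ aff (DiffOp l m))
    (hd : ∀ x y, c ⁅x, y⁆ = ⁅x, c y⁆ - ⁅y, c x⁆)
    (hdet : symb c 2 (r + 1) * (r + 3 * l) = symb c 3 r * (r + 1 + 2 * l)) :
    ∃ v ∈ relZeroCochain ℝ aff (DiffOp l m), d₀₁ ℝ (DiffOp l m) v = c := by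
  obtain ⟨v, hv, hs⟩ := exists_invariant (l := l) (m := m) (r + 2) (by rw [hm]; push_cast; ring)
  have s2 : symb (d₀₁ ℝ (DiffOp l m) v) 2 (r + 1) = r + 1 + 2 * l := by
    rw [hs 0 (r + 1) (by ring)]; push_cast; ring
  have s3 : symb (d₀₁ ℝ (DiffOp l m) v) 3 r = r + 3 * l := by
    rw [hs 1 r (by ring)]; push_cast; ring
  obtain ⟨t, t2, t3⟩ : ∃ t : ℝ, symb c 2 (r + 1) = t * (r + 1 + 2 * l) ∧
      symb c 3 r = t * (r + 3 * l) := by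
    -- The two leading symbols of the coboundary cannot both vanish, because 3(r + 1 + 2l) − 2(r +
    -- 3l) = r + 3 > 0.
    by_cases h2 : (r : ℝ) + 1 + 2 * l = 0
    · have h3 : (r : ℝ) + 3 * l ≠ 0 := by
        intro h3
        have : (0 : ℝ) ≤ r := r.cast_nonneg
        linarith
      refine ⟨symb c 3 r / (r + 3 * l), ?_, by field_simp⟩
      rw [h2, mul_zero] at hdet
      rw [h2, mul_zero, (mul_eq_zero.1 hdet).resolve_right h3]
    · refine ⟨symb c 2 (r + 1) / (r + 1 + 2 * l), by field_simp, ?_⟩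
      rw [div_mul_eq_mul_div, hdet, mul_div_cancel_right₀ _ h2]
  refine ⟨t • v, Submodule.smul_mem _ t hv, ?_⟩
  rw [map_smul]
  have hc' : c - t • d₀₁ ℝ (DiffOp l m) v ∈ relOneCochain ℝ aff (DiffOp l m) :=
    Submodule.sub_mem _ hc (Submodule.smul_mem _ t (d₀₁_mem_relOneCochain hv))
  refine (sub_eq_zero.1 (eq_zero_of_symb_two_three hc' ?_ (fun k => ?_) (fun k => ?_))).symm
  · intro x y
    simp only [LinearMap.sub_apply, LinearMap.smul_apply, hd, d₀₁_isCocycle, lie_sub, lie_smul,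
      smul_sub]
    abel
  · by_cases hk : k = r + 1
    · rw [hk, symb_sub, symb_smul, s2, t2, sub_self]
    · exact symb_eq_zero_of_ne (n := r + 2) hc' (by rw [hm]; push_cast; ring) (by omega)
  · by_cases hk : k = r
    · rw [hk, symb_sub, symb_smul, s3, t3, sub_self]
    · exact symb_eq_zero_of_ne (n := r + 2) hc' (by rw [hm]; push_cast; ring) (by omega)

/-- Both symbols are multiples of the same number, the constant term of `v` on X^(r+2). -/
lemma det_of_isCoboundary (v : DiffOp l m) (r : ℕ) :
    symb (d₀₁ ℝ (DiffOp l m) v) 2 (r + 1) * (r + 3 * l) =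
      symb (d₀₁ ℝ (DiffOp l m) v) 3 r * (r + 1 + 2 * l) := by
  rw [symb_d₀₁ v 0 (r + 1), symb_d₀₁ v 1 r, show 0 + (r + 1) + 1 = 1 + r + 1 by ring]
  push_cast
  ring

/-! ### Obstructions in weight at least 5. -/

/-- The cocycle condition on symbols of total degree `n + 1`. -/
lemma symb_relation {c : Vect →ₗ[ℝ] DiffOp l m}
    (hd : ∀ x y, c ⁅x, y⁆ = ⁅x, c y⁆ - ⁅y, c x⁆) (n : ℕ) :
    ∃ γ : ℕ → ℝ, (∀ p, γ p = symb c p (n + 1 - p)) ∧ ∀ a b k : ℕ, a + b + k + 2 = n →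
      ((b : ℝ) - a) * γ (a + b + 3) =
        (k + l * (b + 2)) * γ (a + 2) - (k + l * (a + 2)) * γ (b + 2) := by
  refine ⟨fun p => symb c p (n + 1 - p), fun _ => rfl, fun a b k h => ?_⟩
  have := symb_cocycle hd a b k
  simp only
  rw [show n + 1 - (a + b + 3) = k by omega, show n + 1 - (a + 2) = b + k + 1 by omega,
    show n + 1 - (b + 2) = a + k + 1 by omega, this]

/-- The obstruction coming from the relation for `X³` and `X⁴`. -/
lemma det_obstruction {c : Vect →ₗ[ℝ] DiffOp l m}
    (hd : ∀ x y, c ⁅x, y⁆ = ⁅x, c y⁆ - ⁅y, c x⁆) (k : ℕ) :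
    ((2 * l + k + 4) ^ 2 - (3 * k + 16)) *
      (symb c 2 (k + 4) * (k + 3 + 3 * l) - symb c 3 (k + 3) * (k + 4 + 2 * l)) = 0 := by
  obtain ⟨γ, hγ, hr⟩ := symb_relation hd (k + 5)
  -- The relations with X² express γ 4, γ 5, γ 6 through γ 2 and γ 3; `h34` gives γ 6 a second time,
  -- and the two values must agree.
  have h4 := hr 0 1 (k + 2) (by ring)
  have h5 := hr 0 2 (k + 1) (by ring)
  have h6 := hr 0 3 k (by ring)
  have h34 := hr 1 2 k (by ring)
  have g2 : γ 2 = symb c 2 (k + 4) := hγ 2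
  have g3 : γ 3 = symb c 3 (k + 3) := hγ 3
  rw [← g2, ← g3]
  norm_num at h4 h5 h6 h34
  have h5' := eq_div_of_mul_eq (by norm_num) ((mul_comm _ _).trans h5)
  have h6' := eq_div_of_mul_eq (by norm_num) ((mul_comm _ _).trans h6)
  rw [h6', h5', h4] at h34
  linear_combination 6 * h34

/-- The obstruction coming from the relation for `X⁴` and `X⁵`. -/
lemma det_obstruction' {c : Vect →ₗ[ℝ] DiffOp l m}
    (hd : ∀ x y, c ⁅x, y⁆ = ⁅x, c y⁆ - ⁅y, c x⁆) (k : ℕ)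
    (hl : (2 * l + k + 6) ^ 2 = 3 * k + 22) :
    symb c 2 (k + 6) * (k + 5 + 3 * l) = symb c 3 (k + 5) * (k + 6 + 2 * l) := by
  obtain ⟨γ, hγ, hr⟩ := symb_relation hd (k + 7)
  -- Here γ 8 is computed twice, from (X², X⁷) and from (X⁴, X⁵).
  have h4 := hr 0 1 (k + 4) (by ring)
  have h5 := hr 0 2 (k + 3) (by ring)
  have h6 := hr 0 3 (k + 2) (by ring)
  have h7 := hr 0 4 (k + 1) (by ring)
  have h8 := hr 0 5 k (by ring)
  have h45 := hr 2 3 k (by ring)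
  have g2 : γ 2 = symb c 2 (k + 6) := hγ 2
  have g3 : γ 3 = symb c 3 (k + 5) := hγ 3
  rw [← g2, ← g3]
  norm_num at h4 h5 h6 h7 h8 h45
  have h5' := eq_div_of_mul_eq (by norm_num) ((mul_comm _ _).trans h5)
  have h6' := eq_div_of_mul_eq (by norm_num) ((mul_comm _ _).trans h6)
  have h7' := eq_div_of_mul_eq (by norm_num) ((mul_comm _ _).trans h7)
  have h8' := eq_div_of_mul_eq (by norm_num) ((mul_comm _ _).trans h8)
  rw [h8', h7', h6', h5', h4] at h45
  -- In the variable y the hypothesis is y² = 3k + 22. Modulo it, `h45` becomes a constant times (k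
  -- + 7)(k + 6) times the determinant.
  have hy : ∃ y : ℝ, l = (y - k - 6) / 2 ∧ y ^ 2 = 3 * k + 22 := ⟨2 * l + k + 6, by ring, hl⟩
  obtain ⟨y, rfl, hy⟩ := hy
  have hk : ((k : ℝ) + 7) * (k + 6) ≠ 0 := by positivity
  refine mul_left_cancel₀ hk ?_
  linear_combination (120 / 9) * h45 + (1 / 9) * (-y ^ 2 + 20 * y - 35 - (3 * k + 22)) *
    (γ 2 * (k + 5 + 3 * ((y - k - 6) / 2)) - γ 3 * (k + 6 + 2 * ((y - k - 6) / 2))) * hy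

/-! ### Vanishing in the non-resonant weights. -/

lemma subsingleton_of_isCoboundary
    (h : ∀ c ∈ Z1 l m, ∃ v ∈ relZeroCochain ℝ aff (DiffOp l m), d₀₁ ℝ (DiffOp l m) v = c) :
    Subsingleton (H1 l m) := by
  refine subsingleton_of_forall_eq 0 fun y => ?_
  obtain ⟨c, rfl⟩ := RelH1.mk_surjective y
  exact (RelH1.mk_eq_zero_iff c).2 (h c c.2)

/-- The cohomology vanishes unless `m - l` is a positive integer. -/
lemma subsingleton_of_forall_ne (h : ∀ n : ℕ, m - l ≠ n + 1) : Subsingleton (H1 l m) := by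
  refine subsingleton_of_isCoboundary fun c hc => ⟨0, Submodule.zero_mem _, ?_⟩
  obtain ⟨hc, -, hd⟩ := mem_relOneCocycle.1 hc
  rw [map_zero]
  refine (eq_zero_of_symb_two_three hc hd (fun k => ?_) (fun k => ?_)).symm
  · refine (mul_eq_zero.1 (symb_weight hc 2 k)).resolve_left fun h0 => h k ?_
    push_cast at h0; linarith
  · refine (mul_eq_zero.1 (symb_weight hc 3 k)).resolve_left fun h0 => h (k + 1) ?_
    push_cast at h0 ⊢; linarith

/-- In weight 1 the only possible symbol is at (2, 0), where the standard coboundary has the value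
2l ≠ 0. -/
lemma subsingleton_of_sub_eq_one (hm : m = l + 1) (hl : l ≠ 0) : Subsingleton (H1 l m) := by
  refine subsingleton_of_isCoboundary fun c hc => ?_
  obtain ⟨hc, -, hd⟩ := mem_relOneCocycle.1 hc
  have hm' : m = l + (1 : ℕ) := by rw [hm, Nat.cast_one]
  obtain ⟨v, hv, hs⟩ := exists_invariant 1 hm'
  have s2 : symb (d₀₁ ℝ (DiffOp l m) v) 2 0 = 2 * l := by
    rw [hs 0 0 (by ring)]; push_cast; ring
  refine ⟨(symb c 2 0 / (2 * l)) • v, Submodule.smul_mem _ _ hv, ?_⟩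
  rw [map_smul]
  have hc' : c - (symb c 2 0 / (2 * l)) • d₀₁ ℝ (DiffOp l m) v ∈
      relOneCochain ℝ aff (DiffOp l m) :=
    Submodule.sub_mem _ hc (Submodule.smul_mem _ _ (d₀₁_mem_relOneCochain hv))
  refine (sub_eq_zero.1 (eq_zero_of_symb_two_three hc' ?_ (fun k => ?_) (fun k => ?_))).symm
  · intro x y
    simp only [LinearMap.sub_apply, LinearMap.smul_apply, hd, d₀₁_isCocycle, lie_sub, lie_smul,
      smul_sub]
    abel
  · by_cases hk : k = 0
    · rw [hk, symb_sub, symb_smul, s2]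
      field_simp
      ring
    · exact symb_eq_zero_of_ne hc' hm' (by omega)
  · exact symb_eq_zero_of_ne hc' hm' (by omega)

lemma subsingleton_of_not_resonant (h : ¬ Resonant l m) : Subsingleton (H1 l m) := by
  by_cases hn : ∀ n : ℕ, m - l ≠ n + 1
  · exact subsingleton_of_forall_ne hn
  push Not at hn
  obtain ⟨n, hn⟩ := hn
  simp only [Resonant, not_or, not_and] at h
  obtain ⟨⟨h2, h3, h4⟩, h1, h5, h6⟩ := h
  have hm : m = l + (n + 1) := by linarith
  rcases n with _ | _ | _ | _ | _ | n
  · exact subsingleton_of_sub_eq_one (by rw [hm]; simp)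
      fun hl => h1 hl (by rw [hm, hl]; simp)
  · exact absurd (by rw [hn]; norm_num) h2
  · exact absurd (by rw [hn]; norm_num) h3
  · exact absurd (by rw [hn]; norm_num) h4
  · refine subsingleton_of_isCoboundary fun c hc => ?_
    obtain ⟨hc, -, hd⟩ := mem_relOneCocycle.1 hc
    -- In weight 5 the quadratic factor is (2l + 4)² − 16 = 4l(l + 4).
    have ho := det_obstruction hd 0
    refine isCoboundary_of_det (r := 3) (by rw [hm]; push_cast; ring) hc hd ?_
    push_cast at ho ⊢
    rcases mul_eq_zero.1 ho with ho | ho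
    · have hl : l * (l + 4) = 0 := by linarith
      have h5' : ¬ (l = 0 ∨ l = -4) := fun hl => h5 hl (by rw [hn]; norm_num)
      refine absurd ((mul_eq_zero.1 hl).imp_right fun h => ?_) h5'
      linarith
    · linear_combination ho
  · refine subsingleton_of_isCoboundary fun c hc => ?_
    obtain ⟨hc, -, hd⟩ := mem_relOneCocycle.1 hc
    have ho := det_obstruction hd (n + 1)
    refine isCoboundary_of_det (r := n + 4) (by rw [hm]; push_cast; ring) hc hd ?_
    push_cast at ho ⊢
    rcases mul_eq_zero.1 ho with ho | ho
    -- The weight is n + 6. In weight 6 the factor is (2l + 5)² − 19, whose roots are resonant; in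
    -- higher weight a root is handled by the second obstruction.
    · rcases n with _ | k
      · have h19 : √(19 : ℝ) ^ 2 = 19 := Real.sq_sqrt (by norm_num)
        have hl : (2 * l + 5 + √19) * (2 * l + 5 - √19) = 0 := by
          push_cast at ho
          linear_combination ho - h19
        have h6' : ¬ (l = -(5 + √19) / 2 ∨ l = -(5 - √19) / 2) :=
          fun hl => h6 hl (by rw [hn]; norm_num)
        refine absurd ((mul_eq_zero.1 hl).imp (fun h => ?_) fun h => ?_) h6' <;> linarith
      · push_cast at ho ⊢
        have := det_obstruction' hd k (by linear_combination ho)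
        linear_combination this
    · linear_combination ho

/-! ### Cocycles that generate the cohomology. -/

/-- A line spanned by a nonzero vector that is everything. -/
lemma nonempty_equiv_of_span {W : Type*} [AddCommGroup W] [Module ℝ W] {w : W} (hw : w ≠ 0)
    (h : Submodule.span ℝ {w} = ⊤) : Nonempty (W ≃ₗ[ℝ] ℝ) :=
  ⟨((LinearEquiv.toSpanNonzeroSingleton ℝ W w hw).trans (LinearEquiv.ofTop _ h)).symm⟩

lemma mem_Z1 {c : Vect →ₗ[ℝ] DiffOp l m} (hS : c ∈ diffCochain l m)
    (h1 : ∀ f, bilin c 1 f = 0) (hX : ∀ f, bilin c X f = 0)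
    (hd : ∀ x y, c ⁅x, y⁆ = ⁅x, c y⁆ - ⁅y, c x⁆) : c ∈ Z1 l m := by
  refine mem_relOneCocycle.2 ⟨mem_relOneCochain_lieSpan hd ?_, hS, hd⟩
  rintro x (rfl | rfl)
  · exact DiffOp.ext fun f => by rw [bilin_spec, h1, map_zero]; rfl
  · exact DiffOp.ext fun f => by rw [bilin_spec, hX, map_zero]; rfl

/-- A cocycle whose leading symbols are not proportional to those of a coboundary generates
the cohomology. -/
lemma generates_of_det {r : ℕ} (hm : m = l + (r + 2)) {c : Vect →ₗ[ℝ] DiffOp l m}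
    (hc : c ∈ Z1 l m)
    (hdet : symb c 2 (r + 1) * (r + 3 * l) - symb c 3 r * (r + 1 + 2 * l) ≠ 0) :
    Generates l m (bilin c) ∧ Nonempty (H1 l m ≃ₗ[ℝ] ℝ) := by
  have h0 : RelH1.mk ℝ aff (DiffOp l m) (diffCochain l m) ⟨c, hc⟩ ≠ 0 := by
    rw [Ne, RelH1.mk_eq_zero_iff]
    rintro ⟨v, -, rfl⟩
    exact hdet (sub_eq_zero.2 (det_of_isCoboundary v r))
  have hs : Submodule.span ℝ {RelH1.mk ℝ aff (DiffOp l m) (diffCochain l m) ⟨c, hc⟩} = ⊤ := by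
    refine (Submodule.eq_top_iff'.2 fun y => ?_)
    obtain ⟨d, rfl⟩ := RelH1.mk_surjective y
    rw [Submodule.mem_span_singleton]
    -- The ratio of determinants is the multiple of `c` whose difference from `d` has determinant
    -- zero.
    refine ⟨(symb d.1 2 (r + 1) * (r + 3 * l) - symb d.1 3 r * (r + 1 + 2 * l)) /
      (symb c 2 (r + 1) * (r + 3 * l) - symb c 3 r * (r + 1 + 2 * l)), ?_⟩
    rw [eq_comm, ← sub_eq_zero, ← map_smul, ← map_sub, RelH1.mk_eq_zero_iff]
    set e := d - (_ : ℝ) • (⟨c, hc⟩ : Z1 l m) with he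
    obtain ⟨h1, -, h2⟩ := mem_relOneCocycle.1 e.2
    refine isCoboundary_of_det hm h1 h2 ?_
    rw [he]
    simp only [Submodule.coe_sub, Submodule.coe_smul, symb_sub, symb_smul]
    have := div_mul_cancel₀
      (symb d.1 2 (r + 1) * (r + 3 * l) - symb d.1 3 r * (r + 1 + 2 * l)) hdet
    linear_combination -this
  exact ⟨⟨⟨c, hc⟩, fun _ _ => rfl, hs⟩, nonempty_equiv_of_span h0 hs⟩

/-- In weight 1 there is no symbol at a = 3, so the determinant is replaced by the single symbol at
(2, 0), which is zero for every coboundary when λ = 0. -/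
lemma generates_zero_one {c : Vect →ₗ[ℝ] DiffOp 0 1} (hc : c ∈ Z1 0 1)
    (h2 : symb c 2 0 ≠ 0) :
    Generates 0 1 (bilin c) ∧ Nonempty (H1 0 1 ≃ₗ[ℝ] ℝ) := by
  have h0 : RelH1.mk ℝ aff (DiffOp 0 1) (diffCochain 0 1) ⟨c, hc⟩ ≠ 0 := by
    rw [Ne, RelH1.mk_eq_zero_iff]
    rintro ⟨v, -, rfl⟩
    exact h2 (by rw [symb_d₀₁ v 0 0]; simp)
  have hs : Submodule.span ℝ {RelH1.mk ℝ aff (DiffOp 0 1) (diffCochain 0 1) ⟨c, hc⟩} = ⊤ := by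
    refine (Submodule.eq_top_iff'.2 fun y => ?_)
    obtain ⟨d, rfl⟩ := RelH1.mk_surjective y
    rw [Submodule.mem_span_singleton]
    refine ⟨symb d.1 2 0 / symb c 2 0, ?_⟩
    rw [← map_smul]
    congr 1
    refine (sub_eq_zero.1 ?_).symm
    set e := d - (_ : ℝ) • (⟨c, hc⟩ : Z1 0 1) with he
    obtain ⟨h1, -, h2⟩ := mem_relOneCocycle.1 e.2
    have hm : (1 : ℝ) = 0 + (1 : ℕ) := by simp
    refine Subtype.ext (eq_zero_of_symb_two_three h1 h2 (fun k => ?_)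
      fun k => symb_eq_zero_of_ne h1 hm (by omega))
    by_cases hk : k = 0
    · rw [hk, he]
      simp only [Submodule.coe_sub, Submodule.coe_smul, symb_sub, symb_smul]
      field_simp
      ring
    · exact symb_eq_zero_of_ne h1 hm (by omega)
  exact ⟨⟨⟨c, hc⟩, fun _ _ => rfl, hs⟩, nonempty_equiv_of_span h0 hs⟩

/-! ### Homogeneous cochains with constant coefficients. -/

/-- The cochain `(g, f) ↦ t g^(i) f^(j)`. -/
noncomputable def monoCochain (l m t : ℝ) (i j : ℕ) : Vect →ₗ[ℝ] DiffOp l m where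
  toFun D := ⟨monoOp l m j (C t * dd i (coef D)), isDiffOp_monoOp _ _⟩
  map_add' D E := DiffOp.ext fun f => by
    change monoOp _ _ _ _ _ = monoOp _ _ _ _ _ + monoOp _ _ _ _ _
    rw [monoOp_apply, monoOp_apply, monoOp_apply, ← map_add, coef_add, dd, iterate_map_add, mul_add,
      add_mul]
  map_smul' s D := DiffOp.ext fun f => by
    change monoOp _ _ _ _ _ = s • monoOp _ _ _ _ _
    rw [monoOp_apply, monoOp_apply, ← map_smul, coef_smul, dd, iterate_derivative_smul,
      mul_smul_comm, smul_mul_assoc]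

@[simp] lemma bilin_monoCochain (t : ℝ) (i j : ℕ) (g f : ℝ[X]) :
    bilin (monoCochain l m t i j) g f = C t * dd i g * dd j f := by
  simp only [bilin, monoCochain, LinearMap.coe_mk, AddHom.coe_mk, monoOp_apply, coef_field,
    LinearEquiv.symm_apply_apply]

lemma monoCochain_mem (t : ℝ) (i j : ℕ) : monoCochain l m t i j ∈ diffCochain l m :=
  ⟨Finsupp.single (i, j) (C t), fun g f => by simp⟩

/-- The cochain `(g, f) ↦ ∑ i, a_i g^(i+2) f^(n-1-i)`. -/
noncomputable def homCochain (l m : ℝ) (n : ℕ) (a : ℕ → ℝ) : Vect →ₗ[ℝ] DiffOp l m :=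
  ∑ i ∈ Finset.range n, monoCochain l m (a i) (i + 2) (n - 1 - i)

lemma bilin_homCochain (n : ℕ) (a : ℕ → ℝ) (g f : ℝ[X]) :
    bilin (homCochain l m n a) g f =
      ∑ i ∈ Finset.range n, C (a i) * dd (i + 2) g * dd (n - 1 - i) f := by
  rw [homCochain, ← bilinMap_apply]
  simp only [← bilin_monoCochain (l := l) (m := m)]
  simp [bilinMap_apply, bilin]

lemma homCochain_mem (n : ℕ) (a : ℕ → ℝ) : homCochain l m n a ∈ diffCochain l m :=
  Submodule.sum_mem _ fun _ _ => monoCochain_mem _ _ _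

lemma homCochain_mem_Z1 (n : ℕ) (a : ℕ → ℝ)
    (hd : ∀ x y, homCochain l m n a ⁅x, y⁆ =
      ⁅x, homCochain l m n a y⁆ - ⁅y, homCochain l m n a x⁆) : homCochain l m n a ∈ Z1 l m := by
  refine mem_Z1 (homCochain_mem n a) (fun f => ?_) (fun f => ?_) hd <;>
  · rw [bilin_homCochain]
    refine Finset.sum_eq_zero fun i _ => ?_
    simp [dd]

lemma eval_dd_X_pow (i p : ℕ) :
    (dd i (X ^ p : ℝ[X])).eval 0 = if i = p then (p.factorial : ℝ) else 0 := by
  rw [dd, ← coeff_zero_eq_eval_zero, coeff_iterate_derivative, zero_add, coeff_X_pow,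
    Nat.descFactorial_self]
  split_ifs with h
  · rw [h, nsmul_eq_mul, mul_one]
  · rw [smul_zero]

lemma symb_homCochain {n i : ℕ} (hi : i < n) (a : ℕ → ℝ) :
    symb (homCochain l m n a) (i + 2) (n - 1 - i) =
      a i * (i + 2).factorial * (n - 1 - i).factorial := by
  rw [symb, bilin_homCochain, eval_finsetSum, Finset.sum_eq_single i]
  · simp [eval_mul, eval_dd_X_pow]
  · intro j _ hj
    simp [eval_mul, eval_dd_X_pow, hj]
  · intro h
    exact absurd (Finset.mem_range.2 hi) h

/-- The leading symbols are 2!(r + 1)! a₀ and 3! r! a₁; `hdet` is the determinant criterion divided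
by 2 r!. -/
lemma generates_homCochain {r : ℕ} (hm : m = l + (r + 2)) {a : ℕ → ℝ}
    (hd : ∀ x y, homCochain l m (r + 2) a ⁅x, y⁆ =
      ⁅x, homCochain l m (r + 2) a y⁆ - ⁅y, homCochain l m (r + 2) a x⁆)
    (hdet : (r + 1) * a 0 * (r + 3 * l) - 3 * a 1 * (r + 1 + 2 * l) ≠ 0) :
    Generates l m (bilin (homCochain l m (r + 2) a)) ∧ Nonempty (H1 l m ≃ₗ[ℝ] ℝ) := by
  refine generates_of_det hm (homCochain_mem_Z1 _ _ hd) ?_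
  have h2 := symb_homCochain (l := l) (m := m) (n := r + 2) (i := 0) (by omega) a
  have h3 := symb_homCochain (l := l) (m := m) (n := r + 2) (i := 1) (by omega) a
  rw [show r + 2 - 1 - 0 = r + 1 by omega, zero_add] at h2
  rw [show r + 2 - 1 - 1 = r by omega] at h3
  rw [h2, h3, Nat.factorial_succ r]
  have h : (2 * r.factorial : ℝ) ≠ 0 := by positivity
  convert mul_ne_zero h hdet using 1
  norm_num [Nat.factorial]
  ring

lemma dd_lie (k : ℕ) (l : ℝ) (g f : ℝ[X]) :
    dd k (g * derivative f + C l * derivative g * f) = ∑ j ∈ Finset.range (k + 1),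
      (k.choose j : ℝ[X]) * (dd (k - j) g * dd (j + 1) f + C l * dd (k - j + 1) g * dd j f) := by
  rw [dd, iterate_map_add, mul_assoc, iterate_derivative_C_mul, iterate_derivative_mul,
    iterate_derivative_mul, Finset.mul_sum, ← Finset.sum_add_distrib]
  refine Finset.sum_congr rfl fun j _ => ?_
  simp only [← Function.iterate_succ_apply, nsmul_eq_mul]
  ring

lemma dd_bracket (k : ℕ) (g h : ℝ[X]) :
    dd k (g * derivative h - h * derivative g) = ∑ j ∈ Finset.range (k + 1),
      (k.choose j : ℝ[X]) * (dd (k - j) g * dd (j + 1) h - dd (k - j) h * dd (j + 1) g) := by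
  rw [dd, iterate_map_sub, iterate_derivative_mul, iterate_derivative_mul,
    ← Finset.sum_sub_distrib]
  refine Finset.sum_congr rfl fun j _ => ?_
  simp only [← Function.iterate_succ_apply, nsmul_eq_mul]
  ring

/-- The cocycle condition for `homCochain`, as an identity between formal derivatives. -/
lemma homCochain_isCocycle (n : ℕ) (a : ℕ → ℝ)
    (H : ∀ g h f : ℕ → ℝ[X],
      ∑ i ∈ Finset.range n, C (a i) * (∑ j ∈ Finset.range (i + 3), ((i + 2).choose j : ℝ[X]) *
          (g (i + 2 - j) * h (j + 1) - h (i + 2 - j) * g (j + 1))) * f (n - 1 - i) =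
        ∑ i ∈ Finset.range n, C (a i) *
          ((g 0 * (h (i + 3) * f (n - 1 - i) + h (i + 2) * f (n - 1 - i + 1))
            + C m * g 1 * (h (i + 2) * f (n - 1 - i))
            - h (i + 2) * ∑ j ∈ Finset.range (n - 1 - i + 1), ((n - 1 - i).choose j : ℝ[X]) *
                (g (n - 1 - i - j) * f (j + 1) + C l * g (n - 1 - i - j + 1) * f j))
          - (h 0 * (g (i + 3) * f (n - 1 - i) + g (i + 2) * f (n - 1 - i + 1))
            + C m * h 1 * (g (i + 2) * f (n - 1 - i))
            - g (i + 2) * ∑ j ∈ Finset.range (n - 1 - i + 1), ((n - 1 - i).choose j : ℝ[X]) *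
                (h (n - 1 - i - j) * f (j + 1) + C l * h (n - 1 - i - j + 1) * f j))))
    (x y : Vect) : homCochain l m n a ⁅x, y⁆ =
      ⁅x, homCochain l m n a y⁆ - ⁅y, homCochain l m n a x⁆ := by
  revert x y
  refine (isCocycle_iff _).2 fun g h f => ?_
  have hder : ∀ g : ℝ[X], derivative (bilin (homCochain l m n a) g f) =
      ∑ i ∈ Finset.range n, C (a i) * (dd (i + 3) g * dd (n - 1 - i) f
        + dd (i + 2) g * dd (n - 1 - i + 1) f) := by
    intro g
    rw [bilin_homCochain, derivative_sum]
    refine Finset.sum_congr rfl fun i _ => ?_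
    rw [mul_assoc, derivative_C_mul, derivative_mul, ← Function.iterate_succ_apply' derivative,
      ← Function.iterate_succ_apply' derivative]
  rw [hder, hder]
  simp only [bilin_homCochain, dd_bracket, dd_lie]
  -- In `H` the derivatives are independent symbols, so for given n and coefficients it is a
  -- polynomial identity that `ring` can check.
  refine (H (fun k => dd k g) (fun k => dd k h) (fun k => dd k f)).trans ?_
  simp only [Finset.mul_sum (Finset.range n), ← Finset.sum_add_distrib, ← Finset.sum_sub_distrib]
  refine Finset.sum_congr rfl fun i _ => ?_
  change C (a i) * ((g * _ + C m * derivative g * _ - _) - (h * _ + C m * derivative h * _ - _)) = _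
  ring

/-! ### The explicit generators. -/

lemma generates_one :
    Generates 0 1 (fun g f => dd 2 g * f) ∧ Nonempty (H1 0 1 ≃ₗ[ℝ] ℝ) := by
  have hb : bilin (homCochain 0 1 1 fun _ => 1) = fun g f => dd 2 g * f := by
    funext g f
    simp [bilin_homCochain, dd]
  rw [← hb]
  refine generates_zero_one (homCochain_mem_Z1 _ _ (homCochain_isCocycle _ _ fun g h f => ?_)) ?_
  · simp [Finset.sum_range_succ, Nat.choose]
    ring
  · rw [symb_homCochain (n := 1) (i := 0) one_pos]
    simp

lemma generates_two (l : ℝ) :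
    Generates l (l + 2) (fun g f => dd 3 g * f + 2 * dd 2 g * dd 1 f) ∧
      Nonempty (H1 l (l + 2) ≃ₗ[ℝ] ℝ) := by
  -- Coefficients are listed by increasing order of the derivative of g, from g'' on; the list has
  -- length n, so the default 0 is never used.
  have hb : bilin (homCochain l (l + 2) 2 fun i => [2, 1].getD i 0) =
      fun g f => dd 3 g * f + 2 * dd 2 g * dd 1 f := by
    funext g f
    simp [bilin_homCochain, dd, Finset.sum_range_succ, map_ofNat]
    ring
  rw [← hb]
  refine generates_homCochain (r := 0) (by simp) (homCochain_isCocycle _ _ fun g h f => ?_) ?_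
  · simp [Finset.sum_range_succ, Nat.choose, map_ofNat]
    ring
  -- The weight l cancels and the determinant is −3; likewise it is −4 for n = 3 and 30 for n = 4,
  -- which is why these cocycles generate for every λ.
  · norm_num
    ring_nf
    norm_num

lemma generates_three (l : ℝ) :
    Generates l (l + 3) (fun g f => dd 3 g * dd 1 f + dd 2 g * dd 2 f) ∧
      Nonempty (H1 l (l + 3) ≃ₗ[ℝ] ℝ) := by
  have hb : bilin (homCochain l (l + 3) 3 fun i => [1, 1, 0].getD i 0) =
      fun g f => dd 3 g * dd 1 f + dd 2 g * dd 2 f := by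
    funext g f
    simp [bilin_homCochain, dd, Finset.sum_range_succ]
    ring
  rw [← hb]
  refine generates_homCochain (r := 1) (by norm_num) (homCochain_isCocycle _ _ fun g h f => ?_) ?_
  · simp [Finset.sum_range_succ, Nat.choose, map_ofNat]
    ring
  · norm_num
    ring_nf
    norm_num

lemma generates_four (l : ℝ) :
    Generates l (l + 4) (fun g f =>
      -C l * dd 5 g * f + dd 4 g * dd 1 f - 6 * dd 3 g * dd 2 f - 4 * dd 2 g * dd 3 f) ∧
      Nonempty (H1 l (l + 4) ≃ₗ[ℝ] ℝ) := by
  have hb : bilin (homCochain l (l + 4) 4 fun i => [-4, -6, 1, -l].getD i 0) =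
      fun g f => -C l * dd 5 g * f + dd 4 g * dd 1 f - 6 * dd 3 g * dd 2 f
        - 4 * dd 2 g * dd 3 f := by
    funext g f
    simp [bilin_homCochain, dd, Finset.sum_range_succ, map_ofNat]
    ring
  rw [← hb]
  refine generates_homCochain (r := 2) (by norm_num) (homCochain_isCocycle _ _ fun g h f => ?_) ?_
  · simp [Finset.sum_range_succ, Nat.choose, map_ofNat]
    ring
  · norm_num
    ring_nf
    norm_num

lemma generates_five_zero :
    Generates 0 5 (fun g f =>
      2 * dd 5 g * dd 1 f - 5 * dd 4 g * dd 2 f + 10 * dd 3 g * dd 3 f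
        + 5 * dd 2 g * dd 4 f) ∧ Nonempty (H1 0 5 ≃ₗ[ℝ] ℝ) := by
  have hb : bilin (homCochain 0 5 5 fun i => [5, 10, -5, 2, 0].getD i 0) =
      fun g f => 2 * dd 5 g * dd 1 f - 5 * dd 4 g * dd 2 f + 10 * dd 3 g * dd 3 f
        + 5 * dd 2 g * dd 4 f := by
    funext g f
    simp [bilin_homCochain, dd, Finset.sum_range_succ, map_ofNat]
    ring
  rw [← hb]
  refine generates_homCochain (r := 3) (by norm_num) (homCochain_isCocycle _ _ fun g h f => ?_) ?_
  · simp [Finset.sum_range_succ, Nat.choose, map_ofNat]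
    ring
  · norm_num

lemma generates_five_neg_four :
    Generates (-4) 1 (fun g f =>
      12 * dd 6 g * f + 22 * dd 5 g * dd 1 f + 5 * dd 4 g * dd 2 f
        - 10 * dd 3 g * dd 3 f - 5 * dd 2 g * dd 4 f) ∧ Nonempty (H1 (-4) 1 ≃ₗ[ℝ] ℝ) := by
  have hb : bilin (homCochain (-4) 1 5 fun i => [-5, -10, 5, 22, 12].getD i 0) =
      fun g f => 12 * dd 6 g * f + 22 * dd 5 g * dd 1 f + 5 * dd 4 g * dd 2 f
        - 10 * dd 3 g * dd 3 f - 5 * dd 2 g * dd 4 f := by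
    funext g f
    simp [bilin_homCochain, dd, Finset.sum_range_succ, map_ofNat]
    ring
  rw [← hb]
  refine generates_homCochain (r := 3) (by norm_num) (homCochain_isCocycle _ _ fun g h f => ?_) ?_
  · simp [Finset.sum_range_succ, Nat.choose, map_ofNat]
    ring
  · norm_num

/-- The cocycle condition for homogeneous cochains of weight `6`. -/
lemma isCocycle_homCochain_six (l a b c d e k : ℝ)
    (h23 : a * (10 + 10 * l) - b * (6 + 4 * l) - 2 * c = 0)
    (h24 : a * (5 + 10 * l) - c * (3 + 3 * l) - 5 * d = 0)
    (h25 : a * (1 + 5 * l) - d * (1 + 2 * l) - 9 * e = 0)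
    (h26 : a * l - e * l - 14 * k = 0)
    (h34 : b * (1 + 4 * l) - c * (1 + 3 * l) - 5 * e = 0)
    (h35 : b * l - d * l - 14 * k = 0) (x y : Vect) :
    homCochain l (l + 6) 6 (fun i => [a, b, c, d, e, k].getD i 0) ⁅x, y⁆ =
      ⁅x, homCochain l (l + 6) 6 (fun i => [a, b, c, d, e, k].getD i 0) y⁆ -
      ⁅y, homCochain l (l + 6) 6 (fun i => [a, b, c, d, e, k].getD i 0) x⁆ := by
  refine homCochain_isCocycle _ _ (fun g h f => ?_) x y
  replace h23 := congrArg C h23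
  replace h24 := congrArg C h24
  replace h25 := congrArg C h25
  replace h26 := congrArg C h26
  replace h34 := congrArg C h34
  replace h35 := congrArg C h35
  simp only [map_add, map_sub, map_mul, map_ofNat, map_one, map_zero] at h23 h24 h25 h26 h34 h35
  simp [Finset.sum_range_succ, Nat.choose, map_ofNat]
  -- Each hypothesis `hij` is, up to sign, the coefficient of (g i · h j − g j · h i) · f (8 − i −
  -- j); these are all the pairs 2 ≤ i < j with i + j ≤ 8.
  linear_combination
    -h23 * (g 2 * h 3 - g 3 * h 2) * f 3
    - h24 * (g 2 * h 4 - g 4 * h 2) * f 2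
    - h25 * (g 2 * h 5 - g 5 * h 2) * f 1
    - h26 * (g 2 * h 6 - g 6 * h 2) * f 0
    - h34 * (g 3 * h 4 - g 4 * h 3) * f 1
    - h35 * (g 3 * h 5 - g 5 * h 3) * f 0

/-- Only s² = 19 enters, so s = √19 and s = −√19 give the two conjugate weights at once. -/
lemma generates_six {s : ℝ} (hs : s ^ 2 = 19) :
    Generates (-(5 + s) / 2) (-(5 + s) / 2 + 6) (fun g f =>
      C (-(22 + 5 * s) / 4) * dd 7 g * f - C ((31 + 7 * s) / 2) * dd 6 g * dd 1 f
        - C ((25 + 7 * s) / 2) * dd 5 g * dd 2 f - 5 * dd 4 g * dd 3 f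
        + 5 * dd 3 g * dd 4 f + 2 * dd 2 g * dd 5 f) ∧
      Nonempty (H1 (-(5 + s) / 2) (-(5 + s) / 2 + 6) ≃ₗ[ℝ] ℝ) := by
  have hb : bilin (homCochain (-(5 + s) / 2) (-(5 + s) / 2 + 6) 6 fun i =>
        [2, 5, -5, -((25 + 7 * s) / 2), -((31 + 7 * s) / 2), -(22 + 5 * s) / 4].getD i 0) =
      fun g f => C (-(22 + 5 * s) / 4) * dd 7 g * f - C ((31 + 7 * s) / 2) * dd 6 g * dd 1 f
        - C ((25 + 7 * s) / 2) * dd 5 g * dd 2 f - 5 * dd 4 g * dd 3 f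
        + 5 * dd 3 g * dd 4 f + 2 * dd 2 g * dd 5 f := by
    funext g f
    simp only [bilin_homCochain, dd, Finset.sum_range_succ, List.getD_cons_succ,
      List.getD_cons_zero, map_neg C, map_ofNat, Finset.range_zero, Finset.sum_empty]
    simp
    ring
  rw [← hb]
  refine generates_homCochain (r := 4) (by norm_num) (isCocycle_homCochain_six _ _ _ _ _ _ _
    ?_ ?_ ?_ ?_ ?_ ?_) ?_
  · ring
  · ring
  · linear_combination (-7 / 2) * hs
  · linear_combination (-7 / 4) * hs
  · ring
  · linear_combination (-7 / 4) * hs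
  -- Here too the weight cancels: the determinant is −35.
  · norm_num
    ring_nf
    norm_num

end AffCohomology

theorem mainTheorem3 :
    (∀ l m : ℝ,
      (Resonant l m → Nonempty (H1 l m ≃ₗ[ℝ] ℝ)) ∧
      (¬ Resonant l m → Subsingleton (H1 l m))) ∧
    Generates 0 1 (fun g f => dd 2 g * f) ∧
    (∀ l : ℝ, Generates l (l + 2) (fun g f => dd 3 g * f + 2 * dd 2 g * dd 1 f)) ∧
    (∀ l : ℝ, Generates l (l + 3) (fun g f => dd 3 g * dd 1 f + dd 2 g * dd 2 f)) ∧
    (∀ l : ℝ, Generates l (l + 4) (fun g f =>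
      -C l * dd 5 g * f + dd 4 g * dd 1 f - 6 * dd 3 g * dd 2 f - 4 * dd 2 g * dd 3 f)) ∧
    Generates 0 5 (fun g f =>
      2 * dd 5 g * dd 1 f - 5 * dd 4 g * dd 2 f + 10 * dd 3 g * dd 3 f
        + 5 * dd 2 g * dd 4 f) ∧
    Generates (-4) 1 (fun g f =>
      12 * dd 6 g * f + 22 * dd 5 g * dd 1 f + 5 * dd 4 g * dd 2 f
        - 10 * dd 3 g * dd 3 f - 5 * dd 2 g * dd 4 f) ∧
    Generates (-(5 + √19) / 2) (-(5 + √19) / 2 + 6) (fun g f =>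
      C (-(22 + 5 * √19) / 4) * dd 7 g * f - C ((31 + 7 * √19) / 2) * dd 6 g * dd 1 f
        - C ((25 + 7 * √19) / 2) * dd 5 g * dd 2 f - 5 * dd 4 g * dd 3 f
        + 5 * dd 3 g * dd 4 f + 2 * dd 2 g * dd 5 f) ∧
    Generates (-(5 - √19) / 2) (-(5 - √19) / 2 + 6) (fun g f =>
      C (-(22 - 5 * √19) / 4) * dd 7 g * f - C ((31 - 7 * √19) / 2) * dd 6 g * dd 1 f
        - C ((25 - 7 * √19) / 2) * dd 5 g * dd 2 f - 5 * dd 4 g * dd 3 f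
        + 5 * dd 3 g * dd 4 f + 2 * dd 2 g * dd 5 f) := by
  have hs : √(19 : ℝ) ^ 2 = 19 := Real.sq_sqrt (by norm_num)
  have h6 := generates_six hs
  have h6' := generates_six (s := -√19) (by rw [neg_sq, hs])
  simp only [mul_neg, ← sub_eq_add_neg] at h6'
  refine ⟨fun l m => ⟨?_, subsingleton_of_not_resonant⟩, generates_one.1,
    fun l => (generates_two l).1, fun l => (generates_three l).1, fun l => (generates_four l).1,
    generates_five_zero.1, generates_five_neg_four.1, h6.1, h6'.1⟩
  rintro ((h | h | h) | ⟨rfl, rfl⟩ | ⟨rfl | rfl, h⟩ | ⟨rfl | rfl, h⟩)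
  · rw [eq_add_of_sub_eq' h]; exact (generates_two l).2
  · rw [eq_add_of_sub_eq' h]; exact (generates_three l).2
  · rw [eq_add_of_sub_eq' h]; exact (generates_four l).2
  · exact generates_one.2
  · obtain rfl : m = 5 := by linarith
    exact generates_five_zero.2
  · obtain rfl : m = 1 := by linarith
    exact generates_five_neg_four.2
  · rw [eq_add_of_sub_eq' h]; exact h6.2
  · rw [eq_add_of_sub_eq' h]; exact h6'.2
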